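/- Let $n\ge 1$ be an integer, $\nu\in\mathbb C$ with $|\operatorname{Re}\nu|<\tfrac12$, and let $J_\mu(z)=\sum_{r\ge 0}\frac{(-1)^r (z/2)^{\mu+2r}}{r!\,\Gamma(\mu+r+1)}$ be the Bessel function of the first kind, with principal powers. The inverse Fourier transform of a function $f$ on $\mathbb R^n$ is the limit, in the space $\mathcal S'(\mathbb R^n)$ of tempered distributions, $$\mathcal F^{-1}[f]=\lim_{\varepsilon\to0+}\frac1{(2\pi)^n}\int_{\mathbb R^n}e^{i\langle x,\xi\rangle-\varepsilon|\xi|}f(\xi)\,d\xi .$$ For $\operatorname{Re}a>-1$ let $G_a\in\mathcal S'(\mathbb R^n)$ be the locally integrable function equal to $(1-|x|^2)^a/\Gamma(a+1)$ for $|x|<1$ and to $0$ for $|x|\ge1$. Then $a\mapsto G_a$ has a unique extension to all $a\in\mathbb C$ with values in $\mathcal S'(\mathbb R^n)$ such that $a\mapsto\langle G_a,\varphi\rangle$ is entire for every Schwartz function $\varphi$, and the limits below exist and satisfy $$\mathcal F^{-1}\big[|\xi|^{-\nu}J_\nu(|\xi|)\big]=\frac{1}{2^{\nu}\pi^{n/2}}\,G_{\nu-n/2},\qquad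 \mathcal F^{-1}\big[|\xi|^{\nu}J_{-\nu}(|\xi|)\big]=\frac{1}{2^{-\nu}\pi^{n/2}}\,G_{-\nu-n/2}.$$ In particular, on the complement of the unit sphere (and on all of $\mathbb R^n$ if $\operatorname{Re}\nu>\frac n2-1$, respectively $-\operatorname{Re}\nu>\frac n2-1$) these distributions are the functions $$\mathcal F^{-1}\big[|\xi|^{-\nu}J_\nu(|\xi|)\big](x)=\begin{cases}\dfrac{(1-|x|^2)^{\nu-n/2}}{2^{\nu}\pi^{n/2}\Gamma(\nu-\frac n2+1)},&|x|<1,\\ 0,&|x|>1,\end{cases}$$ $$\mathcal F^{-1}\big[|\xi|^{\nu}J_{-\nu}(|\xi|)\big](x)=\begin{cases}\dfrac{(1-|x|^2)^{-\nu-n/2}}{2^{-\nu}\pi^{n/2}\Gamma(1-\nu-\frac n2)},&|x|<1,\\ 0,&|x|>1,\end{cases}$$ where $1/\Gamma$ is taken to be $0$ at the poles of $\Gamma$. The last coefficient can also be written $$\frac{1}{2^{-\nu}\pi^{n/2}\Gamma(1-\nu-\frac n2)}=\frac{2^{\nu}\sin\!\big((\nu+\frac n2)\pi\big)\Gamma(\nu+\frac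 n2)}{\pi^{n/2+1}} .$$ -/

import Mathlib

open MeasureTheory Filter Topology
open scoped SchwartzMap

noncomputable section

/-- The Bessel function of the first kind of complex order `ν`, by its power series; powers are
principal powers. Division by `Complex.Gamma` at a pole gives `0`, which is the value of the entire
function `1 / Γ` there. -/
def besselJ (ν z : ℂ) : ℂ :=
  ∑' r : ℕ, (-1) ^ r * z ^ (ν + 2 * r) /
    ((2 : ℂ) ^ (ν + 2 * r) * (r.factorial : ℂ) * Complex.Gamma (ν + r + 1))

/-- The integrand `e^{i⟨x,ξ⟩ - ε|ξ|} f(ξ)` of the inverse Fourier integral with converging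
factor. -/
def invFourierIntegrand {n : ℕ} (f : EuclideanSpace ℝ (Fin n) → ℂ) (ε : ℝ)
    (x ξ : EuclideanSpace ℝ (Fin n)) : ℂ :=
  Complex.exp (Complex.I * ((inner ℝ x ξ : ℝ) : ℂ) - (ε : ℂ) * ((‖ξ‖ : ℝ) : ℂ)) * f ξ

/-- The function `x ↦ (2π)^{-n} ∫ e^{i⟨x,ξ⟩ - ε|ξ|} f(ξ) dξ`. -/
def invFourierDamped {n : ℕ} (f : EuclideanSpace ℝ (Fin n) → ℂ) (ε : ℝ)
    (x : EuclideanSpace ℝ (Fin n)) : ℂ :=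
  (((2 * Real.pi) ^ n : ℝ) : ℂ)⁻¹ * ∫ ξ, invFourierIntegrand f ε x ξ

/-- The tempered distribution `T` is the inverse Fourier transform of the function `f`: the damped
inverse Fourier integrals of `f` converge absolutely, define tempered distributions by
integration, and tend to `T` in the space of tempered distributions as `ε → 0+`. -/
def HasInvFourier {n : ℕ} (f : EuclideanSpace ℝ (Fin n) → ℂ)
    (T : 𝓢'(EuclideanSpace ℝ (Fin n), ℂ)) : Prop :=
  (∀ ε : ℝ, 0 < ε → ∀ x, Integrable (invFourierIntegrand f ε x)) ∧
  (∀ ε : ℝ, 0 < ε → ∀ φ : 𝓢(EuclideanSpace ℝ (Fin n), ℂ),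
    Integrable (fun x => invFourierDamped f ε x * φ x)) ∧
  ∀ φ : 𝓢(EuclideanSpace ℝ (Fin n), ℂ),
    Tendsto (fun ε : ℝ => ∫ x, invFourierDamped f ε x * φ x) (𝓝[>] 0) (𝓝 (T φ))

/-- On the open set `U` the tempered distribution `T` is given by integration against `g`. -/
def RepresentedOn {n : ℕ} (U : Set (EuclideanSpace ℝ (Fin n)))
    (T : 𝓢'(EuclideanSpace ℝ (Fin n), ℂ)) (g : EuclideanSpace ℝ (Fin n) → ℂ) : Prop :=
  ∀ φ : 𝓢(EuclideanSpace ℝ (Fin n), ℂ), tsupport φ ⊆ U →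
    Integrable (fun x => g x * φ x) ∧ T φ = ∫ x, g x * φ x

/-- The function `(1 - |x|²)^a / C` for `|x| < 1`, and `0` for `|x| ≥ 1`. -/
def ballPower (n : ℕ) (a C : ℂ) (x : EuclideanSpace ℝ (Fin n)) : ℂ :=
  if ‖x‖ < 1 then ((1 - ‖x‖ ^ 2 : ℝ) : ℂ) ^ a / C else 0

/-- `G` is the family `a ↦ (1 - |x|²)₊^a / Γ(a + 1)` of tempered distributions: the locally
integrable function for `Re a > -1`, and its analytic continuation for the other `a`. -/
def IsNormalizedBallPowerFamily (n : ℕ) (G : ℂ → 𝓢'(EuclideanSpace ℝ (Fin n), ℂ)) : Prop :=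
  (∀ φ : 𝓢(EuclideanSpace ℝ (Fin n), ℂ), Differentiable ℂ (fun a => G a φ)) ∧
  ∀ a : ℂ, -1 < a.re →
    RepresentedOn Set.univ (G a) (ballPower n a (Complex.Gamma (a + 1)))

/-- The function `|ξ|^s J_μ(|ξ|)`. -/
def powBessel (n : ℕ) (s μ : ℂ) (ξ : EuclideanSpace ℝ (Fin n)) : ℂ :=
  ((‖ξ‖ : ℝ) : ℂ) ^ s * besselJ μ ((‖ξ‖ : ℝ) : ℂ)

/-- The inverse Fourier transform of `f` is the distribution "`(1 - |x|²)^a / (c Γ(a + 1))` for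
`|x| < 1`, and `0` for `|x| > 1`": it is `c⁻¹ (1 - |x|²)₊^a / Γ(a + 1)`, where `G` is the
normalized family; it is the stated function off the unit sphere, and everywhere when that
function is locally integrable. -/
def HasBallPowerInvFourier {n : ℕ} (G : ℂ → 𝓢'(EuclideanSpace ℝ (Fin n), ℂ))
    (f : EuclideanSpace ℝ (Fin n) → ℂ) (a c : ℂ) : Prop :=
  HasInvFourier f (c⁻¹ • G a) ∧
  RepresentedOn {x | ‖x‖ ≠ 1} (c⁻¹ • G a) (ballPower n a (c * Complex.Gamma (a + 1))) ∧
  (-1 < a.re →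
    RepresentedOn Set.univ (c⁻¹ • G a) (ballPower n a (c * Complex.Gamma (a + 1))))

end

/-! For Re a > -1 the transform of (1 - |x|²)₊^a / Γ(a + 1) is computed from its moments. Fubini for
(t - |x|²)₊^a e^{-t} relates moments against a homogeneous polynomial to Gaussian moments: the
t-integral gives Γ(a + 1) e^{-|x|²}, while for fixed t scaling gives a power of t times the ball
moment. Summing the exponential series yields π^{n/2} times the Bessel series of order a + n/2
(`integral_cexp_inner_mul_ballPower`).

This transform is entire in a. The Bessel recurrence, read from right to left in Re a, bounds it by
a polynomial in |ξ|, uniformly for bounded a (`exists_norm_ballPowerFourier_le`). So G_a can be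
defined for every a as the inverse transform of that function. It is entire in a and agrees with the
ball power for Re a > -1; the identity theorem gives uniqueness, and also the formula off the
sphere, where the integrals against test functions are themselves entire.

At a = ν - n/2 the transform is a constant multiple of |ξ|^{-ν} J_ν(|ξ|). Polynomial growth makes
the damped integrals converge to the inverse transform (`hasInvFourier_of_growth`). The second
formula is the first at -ν. -/

noncomputable section

/-! ### The Bessel series as an entire function of order and argument -/

/-- The entire function `∑ (-s/4)^k / (k! Γ(ν + k + 1))`, which is `(z/2)^{-ν} J_ν(z)` at
`s = z²`. -/
def besselEntire (ν s : ℂ) : ℂ :=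
  ∑' k : ℕ, (-s / 4) ^ k / (k.factorial : ℂ) * (Complex.Gamma (ν + k + 1))⁻¹

theorem inv_Gamma_eq_mul (z : ℂ) : (Complex.Gamma z)⁻¹ = z * (Complex.Gamma (z + 1))⁻¹ :=
  Complex.one_div_Gamma_eq_self_mul_one_div_Gamma_add_one z

/-- Passing from k to k + 1 divides by ν + k + 1, whose modulus is at least 1 once k ≥ R + 1, so the
norms stop increasing there; compactness bounds the finitely many earlier terms. -/
theorem exists_norm_inv_Gamma_add_nat_le (R : ℝ) :
    ∃ C : ℝ, 0 ≤ C ∧ ∀ ν : ℂ, ‖ν‖ ≤ R → ∀ k : ℕ, ‖(Complex.Gamma (ν + k + 1))⁻¹‖ ≤ C := by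
  have hb : ∀ k : ℕ, ∃ C : ℝ, ∀ ν : ℂ, ‖ν‖ ≤ R → ‖(Complex.Gamma (ν + k + 1))⁻¹‖ ≤ C := by
    intro k
    have hc : Continuous fun ν : ℂ => (Complex.Gamma (ν + k + 1))⁻¹ :=
      Complex.differentiable_one_div_Gamma.continuous.comp (by fun_prop)
    obtain ⟨C, hC⟩ := (isCompact_closedBall (0 : ℂ) R).exists_bound_of_continuousOn hc.continuousOn
    exact ⟨C, fun ν hν => hC ν (by simpa using hν)⟩
  choose C hC using hb
  obtain ⟨N, hN⟩ := exists_nat_ge (R + 1)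
  refine ⟨∑ k ∈ Finset.range (N + 1), |C k|, Finset.sum_nonneg fun _ _ => abs_nonneg _, ?_⟩
  intro ν hν k
  induction k with
  | zero =>
    refine (hC 0 ν hν).trans ((le_abs_self _).trans ?_)
    exact Finset.single_le_sum (f := fun k => |C k|) (fun _ _ => abs_nonneg _) (by simp)
  | succ k ih =>
    by_cases hk : k + 1 ≤ N
    · refine (hC (k + 1) ν hν).trans ((le_abs_self _).trans ?_)
      exact Finset.single_le_sum (f := fun k => |C k|) (fun _ _ => abs_nonneg _)
        (Finset.mem_range.2 (by omega))
    · refine le_trans ?_ ih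
      rw [inv_Gamma_eq_mul (ν + k + 1), norm_mul]
      have h1 : 1 ≤ ‖ν + k + 1‖ := by
        have h2 : ‖((k : ℂ) + 1)‖ ≤ ‖ν + k + 1‖ + ‖ν‖ := by
          calc ‖((k : ℂ) + 1)‖ = ‖(ν + k + 1) - ν‖ := by congr 1; ring
            _ ≤ _ := norm_sub_le _ _
        have h3 : ‖((k : ℂ) + 1)‖ = k + 1 := by
          have := Complex.norm_natCast (k + 1)
          push_cast at this
          exact this
        have h4 : (N : ℝ) ≤ k := by exact_mod_cast (by omega : N ≤ k)
        linarith
      have h5 : ν + (k + 1 : ℕ) + 1 = ν + k + 1 + 1 := by push_cast; ring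
      rw [h5]
      exact le_mul_of_one_le_left (norm_nonneg _) h1

theorem norm_besselEntire_term_le {C R : ℝ} {s g : ℂ} (hs : ‖s‖ ≤ R) (hg : ‖g‖ ≤ C) (k : ℕ) :
    ‖(-s / 4) ^ k / (k.factorial : ℂ) * g‖ ≤ R ^ k / (k.factorial : ℝ) * C := by
  rw [norm_mul, norm_div, norm_pow, norm_div, norm_neg, Complex.norm_natCast]
  have h4 : ‖(4 : ℂ)‖ = 4 := by simp
  rw [h4]
  have : ‖s‖ / 4 ≤ R := by linarith [norm_nonneg s]
  have hR : 0 ≤ R := (norm_nonneg s).trans hs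
  have : 0 ≤ R ^ k / (k.factorial : ℝ) := by positivity
  gcongr

theorem summable_besselEntire_bound (C R : ℝ) :
    Summable fun k : ℕ => R ^ k / (k.factorial : ℝ) * C :=
  (Real.summable_pow_div_factorial R).mul_right C

theorem summable_besselEntire (ν s : ℂ) :
    Summable fun k : ℕ => (-s / 4) ^ k / (k.factorial : ℂ) * (Complex.Gamma (ν + k + 1))⁻¹ := by
  obtain ⟨C, -, hC⟩ := exists_norm_inv_Gamma_add_nat_le ‖ν‖
  exact Summable.of_norm_bounded (summable_besselEntire_bound C ‖s‖) fun k =>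
    norm_besselEntire_term_le le_rfl (hC ν le_rfl k) k

theorem differentiable_besselEntire_order (s : ℂ) : Differentiable ℂ fun ν => besselEntire ν s := by
  intro ν
  obtain ⟨C, -, hC⟩ := exists_norm_inv_Gamma_add_nat_le (‖ν‖ + 1)
  have := Complex.differentiableOn_tsum_of_summable_norm
    (F := fun (k : ℕ) ν => (-s / 4) ^ k / (k.factorial : ℂ) * (Complex.Gamma (ν + k + 1))⁻¹)
    (U := Metric.ball 0 (‖ν‖ + 1)) (summable_besselEntire_bound C ‖s‖) ?_ Metric.isOpen_ball ?_
  · exact this.differentiableAt (Metric.isOpen_ball.mem_nhds (by simp))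
  · intro k
    refine Differentiable.differentiableOn (Differentiable.const_mul ?_ _)
    exact Complex.differentiable_one_div_Gamma.comp (by fun_prop)
  · intro k w hw
    exact norm_besselEntire_term_le le_rfl (hC w (mem_ball_zero_iff.1 hw).le k) k

theorem continuous_besselEntire (ν : ℂ) : Continuous (besselEntire ν) := by
  obtain ⟨C, -, hC⟩ := exists_norm_inv_Gamma_add_nat_le ‖ν‖
  refine Differentiable.continuous (𝕜 := ℂ) fun s => ?_
  have := Complex.differentiableOn_tsum_of_summable_norm
    (F := fun (k : ℕ) s => (-s / 4) ^ k / (k.factorial : ℂ) * (Complex.Gamma (ν + k + 1))⁻¹)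
    (U := Metric.ball 0 (‖s‖ + 1)) (summable_besselEntire_bound C (‖s‖ + 1)) ?_
    Metric.isOpen_ball ?_
  · exact this.differentiableAt (Metric.isOpen_ball.mem_nhds (by simp))
  · intro k
    fun_prop
  · intro k w hw
    exact norm_besselEntire_term_le (mem_ball_zero_iff.1 hw).le (hC ν le_rfl k) k

theorem hasSum_besselEntire (ν s : ℂ) :
    HasSum (fun k : ℕ => (-s / 4) ^ k / (k.factorial : ℂ) * (Complex.Gamma (ν + k + 1))⁻¹)
      (besselEntire ν s) :=
  (summable_besselEntire ν s).hasSum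

/-- The recurrence `J_ν + J_{ν+2} = 2(ν+1)/z J_{ν+1}` in terms of `besselEntire`. -/
theorem besselEntire_recurrence (ν s : ℂ) :
    besselEntire ν s = (ν + 1) * besselEntire (ν + 1) s - s / 4 * besselEntire (ν + 2) s := by
  have hA := (hasSum_besselEntire (ν + 1) s).mul_left (ν + 1)
  have hB := (hasSum_besselEntire (ν + 2) s).mul_left (-s / 4)
  have hB' : HasSum (fun k : ℕ => (k : ℂ) * ((-s / 4) ^ k / (k.factorial : ℂ)) *
      (Complex.Gamma (ν + k + 2))⁻¹) (-s / 4 * besselEntire (ν + 2) s) := by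
    -- The factor k kills the zeroth term, so the index may be shifted by one.
    rw [← hasSum_nat_add_iff' 1]
    simp only [Finset.range_one, Finset.sum_singleton, Nat.cast_zero, zero_mul, sub_zero]
    refine HasSum.congr_fun hB fun k => ?_
    have h1 : ν + ((k + 1 : ℕ) : ℂ) + 2 = ν + 2 + k + 1 := by push_cast; ring
    have h2 : (k.factorial : ℂ) ≠ 0 := by exact_mod_cast k.factorial_ne_zero
    have h3 : (k : ℂ) + 1 ≠ 0 := by exact_mod_cast k.succ_ne_zero
    rw [h1, Nat.factorial_succ, pow_succ]
    push_cast
    field_simp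
  have hC := hA.add hB'
  rw [sub_eq_add_neg, ← neg_mul, ← neg_div]
  refine (HasSum.congr_fun hC fun k => ?_).tsum_eq
  -- In 1/Γ(ν + k + 1) = ((ν + 1) + k)/Γ(ν + k + 2), the summand ν + 1 gives the first series and k
  -- the second.
  rw [inv_Gamma_eq_mul (ν + k + 1)]
  have h1 : ν + k + 1 + 1 = ν + k + 2 := by ring
  have h2 : ν + 1 + k + 1 = ν + k + 2 := by ring
  rw [h1, h2]
  ring

theorem cpow_neg_mul_besselJ (ν : ℂ) {r : ℝ} (hr : 0 < r) :
    (r : ℂ) ^ (-ν) * besselJ ν r = (2 : ℂ) ^ (-ν) * besselEntire ν ((r : ℂ) ^ 2) := by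
  rw [besselJ, besselEntire, ← tsum_mul_left, ← tsum_mul_left]
  congr 1
  ext k
  have hr' : (r : ℂ) ≠ 0 := by exact_mod_cast hr.ne'
  have key : ∀ z : ℂ, z ≠ 0 → z ^ (ν + 2 * k) = z ^ ν * (z ^ 2) ^ k := by
    intro z hz
    rw [Complex.cpow_add _ _ hz, ← pow_mul]
    congr 1
    exact_mod_cast Complex.cpow_natCast z (2 * k)
  rw [key _ hr', key 2 two_ne_zero, Complex.cpow_neg, Complex.cpow_neg, div_pow,
    neg_pow ((r : ℂ) ^ 2)]
  have h1 : (r : ℂ) ^ ν ≠ 0 := by simp [Complex.cpow_eq_zero_iff, hr']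
  have h2 : (2 : ℂ) ^ ν ≠ 0 := by simp [Complex.cpow_eq_zero_iff]
  have h3 : (4 : ℂ) = 2 ^ 2 := by norm_num
  rw [h3, div_eq_mul_inv, mul_inv, mul_inv, mul_inv]
  field_simp

/-! ### Gaussian moments of a linear form -/

/-- Since |t|^m ≤ m! (e^t + e^{-t}), two Gaussians with linear terms dominate. -/
theorem integrable_inner_pow_mul_exp_neg_sq {V : Type*} [NormedAddCommGroup V]
    [InnerProductSpace ℝ V] [FiniteDimensional ℝ V] [MeasurableSpace V] [BorelSpace V]
    (w : V) (m : ℕ) :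
    Integrable fun x : V => (inner ℝ w x) ^ m * Real.exp (-‖x‖ ^ 2) := by
  have h1 := (GaussianFourier.integrable_cexp_neg_mul_sq_norm_add (V := V) (b := 1) (by simp)
    1 w).norm
  have h2 := (GaussianFourier.integrable_cexp_neg_mul_sq_norm_add (V := V) (b := 1) (by simp)
    (-1) w).norm
  refine Integrable.mono' ((h1.add h2).const_mul (m.factorial : ℝ)) (by fun_prop)
    (ae_of_all _ fun x => ?_)
  have e1 : ∀ c : ℝ, ‖Complex.exp (-1 * (‖x‖ : ℂ) ^ 2 + (c : ℂ) * (inner ℝ w x : ℝ))‖ =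
      Real.exp (c * inner ℝ w x) * Real.exp (-‖x‖ ^ 2) := by
    intro c
    rw [Complex.norm_exp, ← Real.exp_add]
    congr 1
    have : -1 * (‖x‖ : ℂ) ^ 2 + (c : ℂ) * (inner ℝ w x : ℝ) =
      ((-‖x‖ ^ 2 + c * inner ℝ w x : ℝ) : ℂ) := by push_cast; ring
    rw [this, Complex.ofReal_re]
    ring
  have e2 := e1 1
  have e3 := e1 (-1)
  simp only [Complex.ofReal_one, Complex.ofReal_neg] at e2 e3
  simp only [Pi.add_apply]
  rw [e2, e3, ← add_mul, ← mul_assoc, norm_mul, norm_pow, Real.norm_eq_abs, Real.norm_eq_abs,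
    Real.abs_exp]
  refine mul_le_mul_of_nonneg_right ?_ (Real.exp_pos _).le
  have h3 := Real.pow_div_factorial_le_exp |inner ℝ w x| (abs_nonneg _) m
  rw [div_le_iff₀' (by positivity)] at h3
  refine h3.trans (mul_le_mul_of_nonneg_left ?_ (by positivity))
  rw [one_mul, neg_one_mul]
  rcases abs_cases (inner ℝ w x) with h | h <;> rw [h.1] <;>
    linarith [Real.exp_pos (inner ℝ w x), Real.exp_pos (-inner ℝ w x)]

section GaussianMoments

variable {V : Type*} [NormedAddCommGroup V] [InnerProductSpace ℝ V] [FiniteDimensional ℝ V]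
  [MeasurableSpace V] [BorelSpace V]

/-- Integration by parts in the direction w, applied to ⟨w, x⟩^{m+1} and the Gaussian. -/
theorem integral_inner_pow_mul_exp_neg_sq_succ_succ (w : V) (m : ℕ) :
    ∫ x : V, (inner ℝ w x) ^ (m + 2) * Real.exp (-‖x‖ ^ 2) =
      (m + 1) / 2 * ‖w‖ ^ 2 * ∫ x : V, (inner ℝ w x) ^ m * Real.exp (-‖x‖ ^ 2) := by
  have hf : ∀ x : V, HasFDerivAt (fun x : V => (inner ℝ w x) ^ (m + 1))
      (((m + 1 : ℕ) * (inner ℝ w x) ^ m) • innerSL ℝ w) x := fun x => by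
    simpa [nsmul_eq_mul] using ((innerSL ℝ w).hasFDerivAt (x := x)).pow (m + 1)
  have hg : ∀ x : V, HasFDerivAt (fun x : V => Real.exp (-‖x‖ ^ 2))
      (Real.exp (-‖x‖ ^ 2) • (-((2 : ℕ) • innerSL ℝ x : V →L[ℝ] ℝ))) x := fun x =>
    ((hasStrictFDerivAt_norm_sq x).hasFDerivAt.neg).exp
  have hf' : ∀ x : V, fderiv ℝ (fun x : V => (inner ℝ w x) ^ (m + 1)) x w * Real.exp (-‖x‖ ^ 2) =
      (m + 1) * ‖w‖ ^ 2 * ((inner ℝ w x) ^ m * Real.exp (-‖x‖ ^ 2)) := fun x => by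
    rw [(hf x).fderiv]
    simp
    ring
  have hg' : ∀ x : V, (inner ℝ w x) ^ (m + 1) * fderiv ℝ (fun x : V => Real.exp (-‖x‖ ^ 2)) x w =
      -2 * ((inner ℝ w x) ^ (m + 2) * Real.exp (-‖x‖ ^ 2)) := fun x => by
    rw [(hg x).fderiv]
    simp [real_inner_comm w x]
    ring
  have := integral_mul_fderiv_eq_neg_fderiv_mul_of_integrable (μ := (volume : Measure V))
    (f := fun x : V => (inner ℝ w x) ^ (m + 1)) (g := fun x : V => Real.exp (-‖x‖ ^ 2)) (v := w)
    (by simp_rw [hf']; exact (integrable_inner_pow_mul_exp_neg_sq w m).const_mul _)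
    (by simp_rw [hg']; exact (integrable_inner_pow_mul_exp_neg_sq w (m + 2)).const_mul _)
    (integrable_inner_pow_mul_exp_neg_sq w (m + 1))
    (fun x _ => (hf x).differentiableAt) (fun x _ => (hg x).differentiableAt)
  simp_rw [hf', hg', integral_const_mul] at this
  linarith

theorem integral_inner_pow_odd_mul_exp_neg_sq (w : V) (k : ℕ) :
    ∫ x : V, (inner ℝ w x) ^ (2 * k + 1) * Real.exp (-‖x‖ ^ 2) = 0 := by
  have h := integral_neg_eq_self
    (fun x : V => (inner ℝ w x) ^ (2 * k + 1) * Real.exp (-‖x‖ ^ 2)) volume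
  simp only [inner_neg_right, norm_neg, Odd.neg_pow ⟨k, rfl⟩, neg_mul, integral_neg] at h
  linarith

theorem integral_inner_pow_even_mul_exp_neg_sq (w : V) (k : ℕ) :
    ∫ x : V, (inner ℝ w x) ^ (2 * k) * Real.exp (-‖x‖ ^ 2) =
      Real.pi ^ (Module.finrank ℝ V / 2 : ℝ) * ((2 * k).factorial / k.factorial) *
        (‖w‖ ^ 2 / 4) ^ k := by
  induction k with
  | zero =>
    have := GaussianFourier.integral_rexp_neg_mul_sq_norm (V := V) one_pos
    simpa using this
  | succ k ih =>
    rw [show 2 * (k + 1) = 2 * k + 2 by ring, integral_inner_pow_mul_exp_neg_sq_succ_succ, ih,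
      Nat.factorial_succ, Nat.factorial_succ, Nat.factorial_succ k]
    have : (k.factorial : ℝ) ≠ 0 := by exact_mod_cast k.factorial_ne_zero
    push_cast
    field_simp
    ring

end GaussianMoments

/-! ### From Gaussian moments to moments of the ball power -/

theorem ballPower_eq_div (n : ℕ) (a C : ℂ) (x : EuclideanSpace ℝ (Fin n)) :
    ballPower n a C x = ballPower n a 1 x / C := by
  unfold ballPower
  split_ifs <;> simp

theorem measurable_ballPower (n : ℕ) (a C : ℂ) : Measurable (ballPower n a C) := by
  unfold ballPower
  refine Measurable.ite (measurableSet_lt (by fun_prop) (by fun_prop)) ?_ measurable_const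
  have : Measurable fun x : EuclideanSpace ℝ (Fin n) => ((1 - ‖x‖ ^ 2 : ℝ) : ℂ) := by fun_prop
  exact (this.pow_const a).div_const C

/-- The function `(t - |x|²)₊^a e^{-t}`, whose integral over `t` is `Γ(a + 1) e^{-|x|²}`, and
which is for fixed `t > 0` a rescaling of `(1 - |x|²)₊^a`. -/
def coneKernel {n : ℕ} (a : ℂ) (x : EuclideanSpace ℝ (Fin n)) (t : ℝ) : ℂ :=
  if ‖x‖ ^ 2 < t then ((t - ‖x‖ ^ 2 : ℝ) : ℂ) ^ a * (Real.exp (-t) : ℂ) else 0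

theorem measurable_coneKernel {n : ℕ} (a : ℂ) :
    Measurable fun p : EuclideanSpace ℝ (Fin n) × ℝ => coneKernel a p.1 p.2 := by
  unfold coneKernel
  refine Measurable.ite (measurableSet_lt (by fun_prop) (by fun_prop)) ?_ measurable_const
  have : Measurable fun p : EuclideanSpace ℝ (Fin n) × ℝ => ((p.2 - ‖p.1‖ ^ 2 : ℝ) : ℂ) := by
    fun_prop
  exact (this.pow_const a).mul (by fun_prop)

/-- Translating t by |x|² separates the variables; the exponent a + 1 - 1 matches the integrand of
Γ(a + 1). -/
theorem coneKernel_add_sq {n : ℕ} (a : ℂ) (x : EuclideanSpace ℝ (Fin n)) (u : ℝ) :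
    coneKernel a x (u + ‖x‖ ^ 2) = (Real.exp (-‖x‖ ^ 2) : ℂ) *
      (Set.Ioi (0 : ℝ)).indicator (fun u : ℝ => (Real.exp (-u) : ℂ) * (u : ℂ) ^ (a + 1 - 1)) u := by
  unfold coneKernel
  by_cases hu : 0 < u
  · rw [if_pos (by linarith), Set.indicator_of_mem (Set.mem_Ioi.2 hu), add_sub_cancel_right,
      add_sub_cancel_right, neg_add, Real.exp_add]
    push_cast
    ring
  · rw [if_neg (by linarith), Set.indicator_of_notMem (by simpa using hu), mul_zero]

theorem integrable_coneKernel {n : ℕ} {a : ℂ} (ha : -1 < a.re) (x : EuclideanSpace ℝ (Fin n)) :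
    Integrable (coneKernel a x) := by
  have h := Complex.GammaIntegral_convergent (s := a + 1) (by simp; linarith)
  have h2 := ((integrable_indicator_iff measurableSet_Ioi).2 h).const_mul (Real.exp (-‖x‖ ^ 2) : ℂ)
  simp_rw [← coneKernel_add_sq] at h2
  refine (h2.comp_sub_right (‖x‖ ^ 2)).congr (ae_of_all _ fun t => ?_)
  exact congrArg _ (by ring)

theorem integral_coneKernel {n : ℕ} {a : ℂ} (ha : -1 < a.re) (x : EuclideanSpace ℝ (Fin n)) :
    ∫ t, coneKernel a x t = (Real.exp (-‖x‖ ^ 2) : ℂ) * Complex.Gamma (a + 1) := by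
  rw [← integral_add_right_eq_self _ (‖x‖ ^ 2)]
  simp_rw [coneKernel_add_sq]
  rw [integral_const_mul, integral_indicator measurableSet_Ioi,
    Complex.Gamma_eq_integral (by simp; linarith), Complex.GammaIntegral]

theorem integral_norm_coneKernel {n : ℕ} (a : ℂ) (x : EuclideanSpace ℝ (Fin n)) :
    ∫ t, ‖coneKernel a x t‖ =
      Real.exp (-‖x‖ ^ 2) * ∫ t, ‖coneKernel a (0 : EuclideanSpace ℝ (Fin n)) t‖ := by
  rw [← integral_add_right_eq_self _ (‖x‖ ^ 2),
    ← integral_add_right_eq_self (fun t => ‖coneKernel a (0 : EuclideanSpace ℝ (Fin n)) t‖)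
      (‖(0 : EuclideanSpace ℝ (Fin n))‖ ^ 2)]
  simp_rw [coneKernel_add_sq]
  rw [← integral_const_mul]
  congr 1
  ext u
  rw [norm_mul, norm_mul, Complex.norm_real, Real.norm_eq_abs, Real.abs_exp]
  simp

theorem coneKernel_smul {n : ℕ} (a : ℂ) {t : ℝ} (ht : 0 < t) (y : EuclideanSpace ℝ (Fin n)) :
    coneKernel a (√t • y) t = (t : ℂ) ^ a * (Real.exp (-t) : ℂ) * ballPower n a 1 y := by
  unfold coneKernel ballPower
  rw [norm_smul, mul_pow, Real.norm_eq_abs, sq_abs, Real.sq_sqrt ht.le]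
  by_cases hy : ‖y‖ < 1
  · have hy2 : ‖y‖ ^ 2 < 1 := by nlinarith [norm_nonneg y]
    rw [if_pos hy, if_pos (by nlinarith), show t - t * ‖y‖ ^ 2 = t * (1 - ‖y‖ ^ 2) by ring,
      Complex.ofReal_mul, Complex.mul_cpow_ofReal_nonneg ht.le (by linarith)]
    ring
  · have hy2 : 1 ≤ ‖y‖ ^ 2 := by nlinarith [not_lt.1 hy]
    rw [if_neg hy, if_neg (by nlinarith), mul_zero]

theorem coneKernel_of_nonpos {n : ℕ} (a : ℂ) {t : ℝ} (ht : t ≤ 0)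
    (x : EuclideanSpace ℝ (Fin n)) : coneKernel a x t = 0 :=
  if_neg (by nlinarith [sq_nonneg ‖x‖])

section HomogeneousMoments

variable {n : ℕ} {a : ℂ} {p : EuclideanSpace ℝ (Fin n) → ℝ} {m : ℕ}

theorem integrable_prod_mul_coneKernel (ha : -1 < a.re) (hp : Continuous p)
    (hpi : Integrable fun x => p x * Real.exp (-‖x‖ ^ 2)) :
    Integrable (fun q : EuclideanSpace ℝ (Fin n) × ℝ => (p q.1 : ℂ) * coneKernel a q.1 q.2)
      (volume.prod volume) := by
  rw [integrable_prod_iff]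
  · refine ⟨ae_of_all _ fun x => (integrable_coneKernel ha x).const_mul (p x : ℂ), ?_⟩
    have := (hpi.norm).mul_const
      (∫ t, ‖coneKernel a (0 : EuclideanSpace ℝ (Fin n)) t‖)
    refine this.congr (ae_of_all _ fun x => ?_)
    simp only [norm_mul, integral_const_mul]
    rw [integral_norm_coneKernel a x, Complex.norm_real, Real.norm_eq_abs, Real.norm_eq_abs,
      Real.abs_exp]
    ring
  · refine Measurable.aestronglyMeasurable (Measurable.mul ?_ (measurable_coneKernel a))
    have := hp.measurable
    fun_prop

theorem integrable_mul_ballPower (ha : -1 < a.re) (hp : Continuous p)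
    (hpm : ∀ t : ℝ, 0 < t → ∀ x, p (t • x) = t ^ m * p x)
    (hpi : Integrable fun x => p x * Real.exp (-‖x‖ ^ 2)) :
    Integrable fun x => (p x : ℂ) * ballPower n a 1 x := by
  have h := (integrable_prod_mul_coneKernel ha hp hpi).prod_left_ae
  -- Fubini gives integrability for almost every t; a single positive t suffices, since rescaling by
  -- √t turns that slice into the ball power.
  obtain ⟨t, ht0, ht⟩ : ∃ t : ℝ, 0 < t ∧ Integrable fun x => (p x : ℂ) * coneKernel a x t := by
    have h2 := ae_restrict_of_ae (s := Set.Ioi (0 : ℝ)) h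
    rw [ae_restrict_iff' measurableSet_Ioi] at h2
    by_contra! hc
    have : volume (Set.Ioi (0 : ℝ)) = 0 := by
      refine measure_mono_null ?_ (ae_iff.1 h2)
      intro t ht
      exact fun h => hc t ht (h ht)
    simp at this
  have hs : √t ≠ 0 := (Real.sqrt_pos.2 ht0).ne'
  rw [← integrable_comp_smul_iff volume _ hs] at ht
  simp_rw [coneKernel_smul a ht0, hpm _ (Real.sqrt_pos.2 ht0)] at ht
  have hc : ((√t : ℂ) ^ m * ((t : ℂ) ^ a * (Real.exp (-t) : ℂ))) ≠ 0 := by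
    have h1 : (√t : ℂ) ≠ 0 := by exact_mod_cast hs
    have h2 : (t : ℂ) ^ a ≠ 0 := by simp [Complex.cpow_eq_zero_iff, ht0.ne']
    have h3 : (Real.exp (-t) : ℂ) ≠ 0 := by exact_mod_cast (Real.exp_pos _).ne'
    positivity
  refine (ht.const_mul ((√t : ℂ) ^ m * ((t : ℂ) ^ a * (Real.exp (-t) : ℂ)))⁻¹).congr
    (ae_of_all _ fun x => ?_)
  simp only
  rw [inv_mul_eq_iff_eq_mul₀ hc]
  push_cast
  ring

theorem sqrt_pow_mul_cpow {t : ℝ} (ht : 0 < t) (k : ℕ) :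
    ((√t : ℝ) : ℂ) ^ k = (t : ℂ) ^ ((k : ℂ) / 2) := by
  rw [Real.sqrt_eq_rpow, Complex.ofReal_cpow ht.le, ← Complex.cpow_nat_mul]
  congr 1
  push_cast
  ring

theorem integral_mul_coneKernel (hpm : ∀ t : ℝ, 0 < t → ∀ x, p (t • x) = t ^ m * p x)
    {t : ℝ} (ht : 0 < t) :
    ∫ x, (p x : ℂ) * coneKernel a x t =
      (Real.exp (-t) : ℂ) * (t : ℂ) ^ (a + n / 2 + m / 2 + 1 - 1) *
        ∫ x, (p x : ℂ) * ballPower n a 1 x := by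
  have hs : 0 < √t := Real.sqrt_pos.2 ht
  have h := Measure.integral_comp_smul (volume : Measure (EuclideanSpace ℝ (Fin n)))
    (fun x => (p x : ℂ) * coneKernel a x t) √t
  simp_rw [coneKernel_smul a ht, hpm _ hs] at h
  rw [finrank_euclideanSpace_fin, abs_of_pos (by positivity), eq_comm, inv_smul_eq_iff₀
    (by positivity)] at h
  rw [h, ← integral_const_mul, Complex.real_smul, ← integral_const_mul]
  congr 1
  ext x
  have ht' : (t : ℂ) ≠ 0 := by exact_mod_cast ht.ne'
  rw [add_sub_cancel_right, Complex.cpow_add _ _ ht', Complex.cpow_add _ _ ht',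
    ← sqrt_pow_mul_cpow ht, ← sqrt_pow_mul_cpow ht]
  push_cast
  ring

/-- Moments of `(1 - |x|²)₊^a` against a homogeneous function are moments of the Gaussian. -/
theorem Gamma_mul_integral_mul_ballPower (ha : -1 < a.re) (hp : Continuous p)
    (hpm : ∀ t : ℝ, 0 < t → ∀ x, p (t • x) = t ^ m * p x)
    (hpi : Integrable fun x => p x * Real.exp (-‖x‖ ^ 2)) :
    Complex.Gamma (a + n / 2 + m / 2 + 1) * ∫ x, (p x : ℂ) * ballPower n a 1 x =
      Complex.Gamma (a + 1) * ((∫ x, p x * Real.exp (-‖x‖ ^ 2) : ℝ) : ℂ) := by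
  -- The t-integral first gives Γ(a + 1) times the Gaussian moment; the x-integral first leaves
  -- e^{-t} t^{a+n/2+m/2}, integrating to the other Gamma factor.
  have h := integral_integral_swap (f := fun x t => (p x : ℂ) * coneKernel a x t)
    (integrable_prod_mul_coneKernel ha hp hpi)
  have h1 : ∀ x, ∫ t, (p x : ℂ) * coneKernel a x t =
      Complex.Gamma (a + 1) * ((p x * Real.exp (-‖x‖ ^ 2) : ℝ) : ℂ) := by
    intro x
    rw [integral_const_mul, integral_coneKernel ha]
    push_cast
    ring
  simp_rw [h1] at h
  rw [integral_const_mul, integral_complex_ofReal] at h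
  rw [h, Complex.Gamma_eq_integral, Complex.GammaIntegral, ← integral_mul_const,
    ← integral_indicator measurableSet_Ioi]
  · congr 1
    ext t
    by_cases ht : 0 < t
    · rw [Set.indicator_of_mem (Set.mem_Ioi.2 ht), integral_mul_coneKernel hpm ht]
    · rw [Set.indicator_of_notMem (by simpa using ht)]
      simp [coneKernel_of_nonpos a (not_lt.1 ht)]
  · have h2 : a + n / 2 + m / 2 + 1 = a + ((n / 2 + m / 2 + 1 : ℝ) : ℂ) := by push_cast; ring
    rw [h2, Complex.add_re, Complex.ofReal_re]
    have : (0 : ℝ) ≤ n / 2 + m / 2 := by positivity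
    linarith

end HomogeneousMoments

theorem integrable_ballPower {n : ℕ} {a : ℂ} (ha : -1 < a.re) : Integrable (ballPower n a 1) := by
  have h := integrable_mul_ballPower (n := n) (a := a) (p := fun _ => 1) (m := 0) ha
    continuous_const (by simp) (by simpa using integrable_inner_pow_mul_exp_neg_sq 0 0)
  simpa using h

/-! ### The Fourier transform for Re a > -1 -/

section InnerMoments

variable {n : ℕ} {a : ℂ}

theorem integrable_inner_pow_mul_ballPower (ha : -1 < a.re) (ξ : EuclideanSpace ℝ (Fin n))
    (m : ℕ) : Integrable fun x => (((inner ℝ ξ x) ^ m : ℝ) : ℂ) * ballPower n a 1 x :=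
  integrable_mul_ballPower (m := m) ha (by fun_prop)
    (fun t _ x => by rw [inner_smul_right, mul_pow]) (integrable_inner_pow_mul_exp_neg_sq ξ m)

theorem Gamma_mul_integral_inner_pow_mul_ballPower (ha : -1 < a.re)
    (ξ : EuclideanSpace ℝ (Fin n)) (m : ℕ) :
    Complex.Gamma (a + n / 2 + m / 2 + 1) *
        ∫ x, (((inner ℝ ξ x) ^ m : ℝ) : ℂ) * ballPower n a 1 x =
      Complex.Gamma (a + 1) * ((∫ x, (inner ℝ ξ x) ^ m * Real.exp (-‖x‖ ^ 2) : ℝ) : ℂ) :=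
  Gamma_mul_integral_mul_ballPower ha (by fun_prop)
    (fun t _ x => by rw [inner_smul_right, mul_pow]) (integrable_inner_pow_mul_exp_neg_sq ξ m)

theorem Gamma_add_half_ne_zero (ha : -1 < a.re) (m : ℕ) :
    Complex.Gamma (a + n / 2 + m / 2 + 1) ≠ 0 := by
  refine Complex.Gamma_ne_zero_of_re_pos ?_
  have h2 : a + n / 2 + m / 2 + 1 = a + ((n / 2 + m / 2 + 1 : ℝ) : ℂ) := by push_cast; ring
  rw [h2, Complex.add_re, Complex.ofReal_re]
  have : (0 : ℝ) ≤ n / 2 + m / 2 := by positivity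
  linarith

theorem integral_inner_pow_odd_mul_ballPower (ha : -1 < a.re) (ξ : EuclideanSpace ℝ (Fin n))
    (k : ℕ) : ∫ x, (((inner ℝ ξ x) ^ (2 * k + 1) : ℝ) : ℂ) * ballPower n a 1 x = 0 := by
  have h := Gamma_mul_integral_inner_pow_mul_ballPower ha ξ (2 * k + 1)
  rw [integral_inner_pow_odd_mul_exp_neg_sq, Complex.ofReal_zero, mul_zero] at h
  exact (mul_eq_zero.1 h).resolve_left (Gamma_add_half_ne_zero ha _)

theorem integral_inner_pow_even_mul_ballPower (ha : -1 < a.re) (ξ : EuclideanSpace ℝ (Fin n))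
    (k : ℕ) : ∫ x, (((inner ℝ ξ x) ^ (2 * k) : ℝ) : ℂ) * ballPower n a 1 x =
      Complex.Gamma (a + 1) * ((Real.pi : ℂ) ^ ((n : ℂ) / 2) *
        ((2 * k).factorial / k.factorial) * (‖ξ‖ ^ 2 / 4) ^ k *
        (Complex.Gamma (a + n / 2 + k + 1))⁻¹) := by
  have h := Gamma_mul_integral_inner_pow_mul_ballPower ha ξ (2 * k)
  have hne := Gamma_add_half_ne_zero (n := n) ha (2 * k)
  have hk : a + n / 2 + ((2 * k : ℕ) : ℂ) / 2 + 1 = a + n / 2 + k + 1 := by push_cast; ring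
  rw [hk] at h hne
  rw [integral_inner_pow_even_mul_exp_neg_sq, finrank_euclideanSpace_fin, mul_comm,
    ← eq_mul_inv_iff_mul_eq₀ hne] at h
  rw [h]
  push_cast
  rw [Complex.ofReal_cpow Real.pi_pos.le]
  push_cast
  ring

/-- The Fourier transform of `(1 - |x|²)₊^a`. -/
theorem integral_cexp_inner_mul_ballPower (ha : -1 < a.re) (ξ : EuclideanSpace ℝ (Fin n)) :
    ∫ x, Complex.exp (Complex.I * (inner ℝ ξ x : ℝ)) * ballPower n a 1 x =
      Complex.Gamma (a + 1) *
        ((Real.pi : ℂ) ^ ((n : ℂ) / 2) * besselEntire (a + n / 2) (‖ξ‖ ^ 2)) := by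
  set F : ℕ → EuclideanSpace ℝ (Fin n) → ℂ := fun m x =>
    Complex.I ^ m / m.factorial * ((((inner ℝ ξ x) ^ m : ℝ) : ℂ) * ballPower n a 1 x) with hF
  have hint : ∀ m, Integrable (F m) := fun m =>
    (integrable_inner_pow_mul_ballPower ha ξ m).const_mul _
  have hle : ∀ m x, ‖F m x‖ ≤ ‖ξ‖ ^ m / m.factorial * ‖ballPower n a 1 x‖ := by
    intro m x
    simp only [hF, norm_mul, norm_div, norm_pow, Complex.norm_I, one_pow, Complex.norm_natCast,
      Complex.norm_real, Real.norm_eq_abs]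
    by_cases hx : ‖x‖ < 1
    · have h1 : |inner ℝ ξ x| ≤ ‖ξ‖ := (abs_real_inner_le_norm ξ x).trans
        (mul_le_of_le_one_right (norm_nonneg _) hx.le)
      rw [← mul_assoc, div_mul_eq_mul_div, one_mul]
      gcongr
    · simp [ballPower, hx]
  -- On the ball |⟨ξ, x⟩| ≤ |ξ|, so an exponential series dominates and termwise integration is
  -- allowed.
  have hsum : Summable fun m => ∫ x, ‖F m x‖ := by
    refine Summable.of_nonneg_of_le (fun m => integral_nonneg fun x => norm_nonneg _) (fun m => ?_)
      ((Real.summable_pow_div_factorial ‖ξ‖).mul_right (∫ x, ‖ballPower n a 1 x‖))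
    rw [← integral_const_mul]
    exact integral_mono (hint m).norm ((integrable_ballPower ha).norm.const_mul _) (hle m)
  have h := hasSum_integral_of_summable_integral_norm hint hsum
  have hexp : ∀ x, ∑' m, F m x =
      Complex.exp (Complex.I * (inner ℝ ξ x : ℝ)) * ballPower n a 1 x := by
    intro x
    have h1 := (NormedSpace.expSeries_div_hasSum_exp (Complex.I * (inner ℝ ξ x : ℝ))).mul_right
      (ballPower n a 1 x)
    rw [← Complex.exp_eq_exp_ℂ] at h1
    refine (HasSum.congr_fun h1 fun m => ?_).tsum_eq
    simp only [hF, mul_pow]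
    push_cast
    ring
  simp_rw [hexp] at h
  -- Odd moments vanish, so only the even indices contribute.
  have hinj : Function.Injective fun k : ℕ => 2 * k := fun _ _ h => by simpa using h
  rw [← hinj.hasSum_iff] at h
  · refine h.unique (HasSum.congr_fun ((hasSum_besselEntire (a + n / 2) (‖ξ‖ ^ 2)).mul_left
      ((Real.pi : ℂ) ^ ((n : ℂ) / 2)) |>.mul_left (Complex.Gamma (a + 1))) fun k => ?_)
    simp only [hF, Function.comp_apply]
    rw [integral_const_mul, integral_inner_pow_even_mul_ballPower ha, pow_mul, Complex.I_sq,
      neg_div, neg_pow ((‖ξ‖ : ℂ) ^ 2 / 4)]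
    have h1 : (k.factorial : ℂ) ≠ 0 := by exact_mod_cast k.factorial_ne_zero
    have h2 : ((2 * k).factorial : ℂ) ≠ 0 := by exact_mod_cast (2 * k).factorial_ne_zero
    field_simp
  · intro m hm
    have hodd : Odd m := by
      rw [← Nat.not_even_iff_odd]
      rintro ⟨k, rfl⟩
      exact hm ⟨k, by simp; ring⟩
    obtain ⟨k, rfl⟩ := hodd
    simp only [hF]
    rw [integral_const_mul, integral_inner_pow_odd_mul_ballPower ha, mul_zero]

end InnerMoments

/-! ### The transform for all a and its polynomial growth -/

/-- The Fourier transform `π^{n/2} (|ξ|/2)^{-a-n/2} J_{a+n/2}(|ξ|)` of `(1 - |x|²)₊^a / Γ(a + 1)`,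
as an entire function of `a`. -/
def ballPowerFourier (n : ℕ) (a : ℂ) (ξ : EuclideanSpace ℝ (Fin n)) : ℂ :=
  (Real.pi : ℂ) ^ ((n : ℂ) / 2) * besselEntire (a + n / 2) (‖ξ‖ ^ 2)

theorem integral_cexp_mul_ballPower {n : ℕ} {a : ℂ} (ha : -1 < a.re)
    (ξ : EuclideanSpace ℝ (Fin n)) :
    ∫ x, Complex.exp (Complex.I * (inner ℝ ξ x : ℝ)) * ballPower n a (Complex.Gamma (a + 1)) x =
      ballPowerFourier n a ξ := by
  simp_rw [ballPower_eq_div n a (Complex.Gamma (a + 1)), mul_div_assoc']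
  rw [integral_div, integral_cexp_inner_mul_ballPower ha, mul_div_cancel_left₀ _
    (Complex.Gamma_ne_zero_of_re_pos (by simp; linarith)), ballPowerFourier]

theorem continuous_ballPowerFourier (n : ℕ) (a : ℂ) : Continuous (ballPowerFourier n a) :=
  continuous_const.mul ((continuous_besselEntire _).comp (by fun_prop))

theorem differentiable_ballPowerFourier {n : ℕ} (ξ : EuclideanSpace ℝ (Fin n)) :
    Differentiable ℂ fun a => ballPowerFourier n a ξ :=
  ((differentiable_besselEntire_order _).comp (differentiable_id.add_const _)).const_mul _

theorem ballPowerFourier_recurrence {n : ℕ} (a : ℂ) (ξ : EuclideanSpace ℝ (Fin n)) :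
    ballPowerFourier n a ξ = (a + n / 2 + 1) * ballPowerFourier n (a + 1) ξ -
      ‖ξ‖ ^ 2 / 4 * ballPowerFourier n (a + 2) ξ := by
  simp only [ballPowerFourier]
  rw [besselEntire_recurrence, show a + 1 + (n : ℂ) / 2 = a + n / 2 + 1 by ring,
    show a + 2 + (n : ℂ) / 2 = a + n / 2 + 2 by ring]
  ring

theorem norm_ballPower_le {n : ℕ} {a : ℂ} (ha : 0 ≤ a.re) (x : EuclideanSpace ℝ (Fin n)) :
    ‖ballPower n a 1 x‖ ≤ (Metric.ball (0 : EuclideanSpace ℝ (Fin n)) 1).indicator 1 x := by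
  unfold ballPower
  split_ifs with hx
  · have h1 : 0 < 1 - ‖x‖ ^ 2 := by nlinarith [norm_nonneg x]
    rw [Set.indicator_of_mem (by simpa using hx), div_one, Complex.norm_cpow_eq_rpow_re_of_pos h1]
    exact Real.rpow_le_one h1.le (by nlinarith [norm_nonneg x]) ha
  · rw [norm_zero]
    exact Set.indicator_nonneg (by simp) _

theorem norm_ballPowerFourier_le {n : ℕ} {a : ℂ} (ha : 0 ≤ a.re)
    (ξ : EuclideanSpace ℝ (Fin n)) :
    ‖ballPowerFourier n a ξ‖ ≤ ‖(Complex.Gamma (a + 1))⁻¹‖ *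
      volume.real (Metric.ball (0 : EuclideanSpace ℝ (Fin n)) 1) := by
  rw [← integral_cexp_mul_ballPower (by linarith)]
  simp_rw [ballPower_eq_div n a (Complex.Gamma (a + 1)), mul_div_assoc']
  rw [integral_div, div_eq_mul_inv, norm_mul, mul_comm]
  refine mul_le_mul_of_nonneg_left ?_ (norm_nonneg _)
  rw [← integral_indicator_one Metric.isOpen_ball.measurableSet]
  refine norm_integral_le_of_norm_le ?_ (ae_of_all _ fun x => ?_)
  · exact (integrable_indicator_iff Metric.isOpen_ball.measurableSet).2
      (integrableOn_const Metric.isBounded_ball.measure_lt_top.ne)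
  · rw [norm_mul, mul_comm Complex.I, Complex.norm_exp_ofReal_mul_I, one_mul]
    exact norm_ballPower_le ha x

/-- For Re a ≥ 0 the transform of a bounded function on the ball is bounded. Each unit step to the
left uses the recurrence through a + 1 and a + 2: it costs a factor (1 + |ξ|)² and requires the
bound on the disc of radius R + 2. -/
theorem exists_norm_ballPowerFourier_le_of_le_re (n N : ℕ) (R : ℝ) :
    ∃ (C : ℝ) (k : ℕ), 0 ≤ C ∧ ∀ a : ℂ, ‖a‖ ≤ R → -(N : ℝ) ≤ a.re →
      ∀ ξ : EuclideanSpace ℝ (Fin n), ‖ballPowerFourier n a ξ‖ ≤ C * (1 + ‖ξ‖) ^ k := by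
  induction N generalizing R with
  | zero =>
    obtain ⟨C, hC0, hC⟩ := exists_norm_inv_Gamma_add_nat_le R
    refine ⟨C * volume.real (Metric.ball (0 : EuclideanSpace ℝ (Fin n)) 1), 0, by positivity,
      fun a ha hre ξ => ?_⟩
    rw [pow_zero, mul_one]
    refine (norm_ballPowerFourier_le (by simpa using hre) ξ).trans ?_
    have := hC a ha 0
    rw [Nat.cast_zero, add_zero] at this
    gcongr
  | succ N ih =>
    obtain ⟨C, k, hC0, hC⟩ := ih (R + 2)
    refine ⟨(|R| + n / 2 + 1) * C + C, k + 2, by positivity, fun a ha hre ξ => ?_⟩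
    push_cast at hre
    have n1 : ‖a + 1‖ ≤ R + 2 := (norm_add_le _ _).trans (by simp; linarith)
    have n2 : ‖a + 2‖ ≤ R + 2 := (norm_add_le _ _).trans (by simp; linarith)
    have b1 := hC (a + 1) n1 (by simp; linarith) ξ
    have b2 := hC (a + 2) n2 (by simp; linarith) ξ
    have h0 : 1 ≤ 1 + ‖ξ‖ := by linarith [norm_nonneg ξ]
    have h1 : ‖a + n / 2 + 1‖ ≤ |R| + n / 2 + 1 := by
      refine (norm_add₃_le ..).trans ?_
      have : ‖(n : ℂ) / 2‖ = n / 2 := by simp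
      rw [this, norm_one]
      linarith [le_abs_self R]
    have h2 : ‖(‖ξ‖ : ℂ) ^ 2 / 4‖ ≤ (1 + ‖ξ‖) ^ 2 := by
      have : ‖(‖ξ‖ : ℂ) ^ 2 / 4‖ = ‖ξ‖ ^ 2 / 4 := by simp
      rw [this]
      nlinarith [norm_nonneg ξ]
    rw [ballPowerFourier_recurrence]
    calc _ ≤ (|R| + n / 2 + 1) * (C * (1 + ‖ξ‖) ^ k) +
          (1 + ‖ξ‖) ^ 2 * (C * (1 + ‖ξ‖) ^ k) := by
          refine (norm_sub_le _ _).trans ?_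
          rw [norm_mul, norm_mul]
          gcongr
      _ ≤ (|R| + n / 2 + 1) * (C * (1 + ‖ξ‖) ^ (k + 2)) +
          (1 + ‖ξ‖) ^ 2 * (C * (1 + ‖ξ‖) ^ k) := by
          gcongr
          omega
      _ = _ := by ring

theorem exists_norm_ballPowerFourier_le (n : ℕ) (R : ℝ) :
    ∃ (C : ℝ) (k : ℕ), 0 ≤ C ∧ ∀ a : ℂ, ‖a‖ ≤ R →
      ∀ ξ : EuclideanSpace ℝ (Fin n), ‖ballPowerFourier n a ξ‖ ≤ C * (1 + ‖ξ‖) ^ k := by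
  obtain ⟨N, hN⟩ := exists_nat_ge R
  obtain ⟨C, k, hC0, hC⟩ := exists_norm_ballPowerFourier_le_of_le_re n N R
  refine ⟨C, k, hC0, fun a ha => hC a ha ?_⟩
  have := (Complex.abs_re_le_norm a).trans ha
  linarith [neg_abs_le a.re]

/-! ### Holomorphic parameter integrals and functions of slow growth -/

/-- An integral of entire functions with locally uniform integrable bounds is entire. -/
theorem differentiable_integral_of_locally_dominated {α : Type*} [MeasurableSpace α]
    {μ : Measure α} {F : ℂ → α → ℂ} (hm : ∀ z, AEStronglyMeasurable (F z) μ)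
    (hd : ∀ x, Differentiable ℂ fun z => F z x)
    (hb : ∀ R : ℝ, ∃ g : α → ℝ, Integrable g μ ∧ ∀ z, ‖z‖ ≤ R → ∀ x, ‖F z x‖ ≤ g x) :
    Differentiable ℂ fun z => ∫ x, F z x ∂μ := by
  intro z₀
  -- Radius 2: the unit ball about z₀, plus the unit circles for Cauchy's estimate.
  obtain ⟨g, hg, hle⟩ := hb (‖z₀‖ + 2)
  refine (hasDerivAt_integral_of_dominated_loc_of_deriv_le (bound := g)
    (F' := fun z x => deriv (fun z => F z x) z) (Metric.ball_mem_nhds z₀ one_pos)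
    (Eventually.of_forall hm) ?_ ?_ ?_ hg ?_).2.differentiableAt
  · exact hg.mono' (hm z₀) (ae_of_all _ (hle z₀ (by linarith)))
  · have ht : Tendsto (fun k : ℕ => 1 / ((k : ℂ) + 1)) atTop (𝓝[≠] 0) := by
      refine tendsto_nhdsWithin_iff.2 ⟨tendsto_one_div_add_atTop_nhds_zero_nat, ?_⟩
      exact Eventually.of_forall fun k => one_div_ne_zero (by exact_mod_cast k.succ_ne_zero)
    refine aestronglyMeasurable_of_tendsto_ae atTop
      (f := fun (k : ℕ) x => (1 / ((k : ℂ) + 1))⁻¹ • (F (z₀ + 1 / ((k : ℂ) + 1)) x - F z₀ x))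
      (fun k => ((hm (z₀ + 1 / ((k : ℂ) + 1))).sub (hm z₀)).const_smul (1 / ((k : ℂ) + 1))⁻¹)
      (ae_of_all _ fun x => ?_)
    exact ((hd x z₀).hasDerivAt.tendsto_slope_zero).comp ht
  · refine ae_of_all _ fun x z hz => ?_
    have := Complex.norm_deriv_le_of_forall_mem_sphere_norm_le (f := fun z => F z x) (c := z)
      (C := g x) one_pos (hd x).diffContOnCl fun w hw => hle w ?_ x
    · simpa using this
    · have h1 : ‖w - z‖ = 1 := by simpa [dist_eq_norm] using hw
      have h2 : ‖z - z₀‖ < 1 := by simpa [dist_eq_norm] using hz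
      calc ‖w‖ = ‖(w - z) + (z - z₀) + z₀‖ := by congr 1; ring
        _ ≤ ‖w - z‖ + ‖z - z₀‖ + ‖z₀‖ := norm_add₃_le
        _ ≤ _ := by linarith
  · exact ae_of_all _ fun x z _ => (hd x z).hasDerivAt

section SlowGrowth

variable {V : Type*} [NormedAddCommGroup V] [InnerProductSpace ℝ V] [FiniteDimensional ℝ V]
  [MeasurableSpace V] [BorelSpace V]

theorem integrable_one_add_norm_pow_mul_schwartz (k : ℕ) (φ : 𝓢(V, ℂ)) :
    Integrable fun x => (1 + ‖x‖) ^ k * ‖φ x‖ := by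
  have h : ∀ x, (1 + ‖x‖) ^ k * ‖φ x‖ ≤
      2 ^ (k - 1) * (‖φ x‖ + ‖x‖ ^ k * ‖φ x‖) := by
    intro x
    have := add_pow_le (zero_le_one' ℝ) (norm_nonneg x) k
    rw [one_pow] at this
    calc _ ≤ (2 ^ (k - 1) * (1 + ‖x‖ ^ k)) * ‖φ x‖ :=
          mul_le_mul_of_nonneg_right this (norm_nonneg _)
      _ = _ := by ring
  refine Integrable.mono' (((φ.integrable.norm).add (φ.integrable_pow_mul volume k)).const_mul
    (2 ^ (k - 1))) (by have := φ.continuous; fun_prop) (ae_of_all _ fun x => ?_)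
  rw [Real.norm_of_nonneg (by positivity)]
  exact h x

theorem integrable_mul_schwartz {K : V → ℂ} {C : ℝ} {k : ℕ} (hK : AEStronglyMeasurable K)
    (hle : ∀ x, ‖K x‖ ≤ C * (1 + ‖x‖) ^ k) (φ : 𝓢(V, ℂ)) : Integrable fun x => K x * φ x := by
  refine Integrable.mono' ((integrable_one_add_norm_pow_mul_schwartz k φ).const_mul C)
    (hK.mul φ.continuous.aestronglyMeasurable) (ae_of_all _ fun x => ?_)
  rw [norm_mul, ← mul_assoc]
  exact mul_le_mul_of_nonneg_right (hle x) (norm_nonneg _)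

/-- Integration against a function of polynomial growth is a tempered distribution. -/
theorem exists_clm_eq_integral_mul {K : V → ℂ} {C : ℝ} {k : ℕ} (hK : AEStronglyMeasurable K)
    (hC : 0 ≤ C) (hle : ∀ x, ‖K x‖ ≤ C * (1 + ‖x‖) ^ k) :
    ∃ T : 𝓢(V, ℂ) →L[ℂ] ℂ, ∀ φ, T φ = ∫ x, K x * φ x := by
  have hi := integrable_mul_schwartz hK hle
  refine ⟨SchwartzMap.mkCLMtoNormedSpace (σ := RingHom.id ℂ) (fun φ => ∫ x, K x * φ x)
    (fun f g => ?_) (fun c f => ?_) ?_, fun φ => rfl⟩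
  · simp only [add_apply, mul_add]
    exact integral_add (hi f) (hi g)
  · simp only [smul_apply, smul_eq_mul, RingHom.id_apply, mul_left_comm _ c]
    exact integral_const_mul _ _
  -- Of the k + l powers of 1 + |x| controlled by the seminorms, k absorb the growth of `K` and l
  -- make the integral converge.
  · set l := (volume : Measure V).integrablePower
    have hl : Integrable fun x : V => (1 + ‖x‖) ^ (-(l : ℝ)) :=
      Measure.integrable_pow_neg_integrablePower _
    refine ⟨Finset.Iic (k + l, 0), C * (2 ^ (k + l) * ∫ x : V, (1 + ‖x‖) ^ (-(l : ℝ))),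
      by positivity, fun φ => ?_⟩
    set S := (Finset.Iic (k + l, 0)).sup (fun m => SchwartzMap.seminorm ℂ m.1 m.2) φ with hS
    have hb : ∀ x, ‖K x * φ x‖ ≤ (C * (2 ^ (k + l) * S)) * (1 + ‖x‖) ^ (-(l : ℝ)) := by
      intro x
      have h1 : (1 + ‖x‖) ^ (k + l) * ‖φ x‖ ≤ 2 ^ (k + l) * S := by
        simpa using SchwartzMap.one_add_le_sup_seminorm_apply (𝕜 := ℂ) (m := (k + l, 0))
          (k := k + l) (n := 0) le_rfl le_rfl φ x
      have h2 : 0 < 1 + ‖x‖ := by positivity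
      rw [norm_mul, Real.rpow_neg h2.le, Real.rpow_natCast, ← div_eq_mul_inv,
        le_div_iff₀ (by positivity)]
      calc _ ≤ C * (1 + ‖x‖) ^ k * ‖φ x‖ * (1 + ‖x‖) ^ l := by gcongr; exact hle x
        _ = C * ((1 + ‖x‖) ^ (k + l) * ‖φ x‖) := by ring
        _ ≤ _ := by gcongr
    refine (norm_integral_le_of_norm_le (hl.const_mul _) (ae_of_all _ hb)).trans ?_
    rw [integral_const_mul]
    refine le_of_eq ?_
    change _ = _ * S
    ring

end SlowGrowth

open scoped FourierTransform

/-! ### Identity theorem and Fourier duality -/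

theorem eq_of_differentiable_of_eq_of_re_gt {f g : ℂ → ℂ} (hf : Differentiable ℂ f)
    (hg : Differentiable ℂ g) {c : ℝ} (h : ∀ a : ℂ, c < a.re → f a = g a) : f = g := by
  refine AnalyticOnNhd.eq_of_eventuallyEq (z₀ := ((c + 1 : ℝ) : ℂ))
    (Complex.analyticOnNhd_univ_iff_differentiable.2 hf)
    (Complex.analyticOnNhd_univ_iff_differentiable.2 hg) ?_
  have ho : IsOpen {a : ℂ | c < a.re} := isOpen_lt continuous_const Complex.continuous_re
  exact eventually_of_mem (ho.mem_nhds (by simp)) fun a ha => h a ha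

theorem IsNormalizedBallPowerFamily.unique {n : ℕ}
    {G G' : ℂ → 𝓢'(EuclideanSpace ℝ (Fin n), ℂ)} (hG : IsNormalizedBallPowerFamily n G)
    (hG' : IsNormalizedBallPowerFamily n G') : G' = G := by
  ext a φ
  refine congrFun (eq_of_differentiable_of_eq_of_re_gt (c := -1) (hG'.1 φ) (hG.1 φ)
    fun a ha => ?_) a
  rw [(hG'.2 a ha φ (Set.subset_univ _)).2, (hG.2 a ha φ (Set.subset_univ _)).2]

section FourierDuality

variable {V : Type*} [NormedAddCommGroup V] [InnerProductSpace ℝ V] [FiniteDimensional ℝ V]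
  [MeasurableSpace V] [BorelSpace V]

theorem integrable_mul_schwartz_of_integrable {u : V → ℂ} (hu : Integrable u) (φ : 𝓢(V, ℂ)) :
    Integrable fun x => u x * φ x :=
  hu.mul_bdd φ.continuous.aestronglyMeasurable
    (ae_of_all _ fun x => φ.toBoundedContinuousFunction.norm_coe_le_norm x)

theorem integral_fourier_mul_eq_of_integrable {f g : V → ℂ} (hf : Integrable f)
    (hg : Integrable g) : ∫ ξ, 𝓕 f ξ * g ξ = ∫ x, f x * 𝓕 g x := by
  simpa using! VectorFourier.integral_fourierIntegral_smul_eq_flip (L := innerₗ V)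
    Real.continuous_fourierChar continuous_inner hf hg

theorem integral_fourierInv_mul_eq_of_integrable {f g : V → ℂ} (hf : Integrable f)
    (hg : Integrable g) : ∫ ξ, 𝓕⁻ f ξ * g ξ = ∫ x, f x * 𝓕⁻ g x := by
  have h := integral_fourier_mul_eq_of_integrable hf hg.comp_neg
  rw [← integral_neg_eq_self] at h
  rw [← Real.fourierInv_eq_fourier_comp_neg g] at h
  simpa only [Real.fourierInv_eq_fourier_neg f, neg_neg] using h

theorem continuous_fourierInv_of_integrable {f : V → ℂ} (hf : Integrable f) :
    Continuous (𝓕⁻ f) := by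
  have h : Continuous (𝓕 f) := VectorFourier.fourierIntegral_continuous (L := innerₗ V)
    Real.continuous_fourierChar continuous_inner hf
  have h2 : 𝓕⁻ f = fun x => 𝓕 f (-x) := funext fun x => Real.fourierInv_eq_fourier_neg f x
  rw [h2]
  exact h.comp continuous_neg

theorem norm_fourierInv_le (f : V → ℂ) (x : V) : ‖𝓕⁻ f x‖ ≤ ∫ y, ‖f y‖ := by
  rw [Real.fourierInv_eq]
  refine (norm_integral_le_integral_norm _).trans (le_of_eq ?_)
  simp

theorem integrable_one_add_norm_pow_mul_exp_neg {ε : ℝ} (hε : 0 < ε) (k : ℕ) :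
    Integrable fun x : V => (1 + ‖x‖) ^ k * Real.exp (-ε * ‖x‖) := by
  set l := (volume : Measure V).integrablePower
  have hl : Integrable fun x : V => (1 + ‖x‖) ^ (-(l : ℝ)) :=
    Measure.integrable_pow_neg_integrablePower _
  refine (hl.const_mul ((k + l).factorial / ε ^ (k + l) * Real.exp ε)).mono' (by fun_prop)
    (ae_of_all _ fun x => ?_)
  have h2 : 0 < 1 + ‖x‖ := by positivity
  rw [Real.norm_of_nonneg (by positivity), Real.rpow_neg h2.le, Real.rpow_natCast,
    ← div_eq_mul_inv, le_div_iff₀ (by positivity)]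
  have h3 := Real.pow_div_factorial_le_exp (ε * (1 + ‖x‖)) (by positivity) (k + l)
  rw [div_le_iff₀ (by positivity), mul_pow, mul_add ε, mul_one, Real.exp_add] at h3
  have h4 : Real.exp (-ε * ‖x‖) * Real.exp (ε * ‖x‖) = 1 := by rw [← Real.exp_add]; simp
  calc (1 + ‖x‖) ^ k * Real.exp (-ε * ‖x‖) * (1 + ‖x‖) ^ l
      = (ε ^ (k + l))⁻¹ * (ε ^ (k + l) * (1 + ‖x‖) ^ (k + l)) * Real.exp (-ε * ‖x‖) := by
        field_simp
        ring
    _ ≤ (ε ^ (k + l))⁻¹ * (Real.exp ε * Real.exp (ε * ‖x‖) * (k + l).factorial) *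
        Real.exp (-ε * ‖x‖) := by gcongr
    _ = (k + l).factorial / ε ^ (k + l) * Real.exp ε *
        (Real.exp (-ε * ‖x‖) * Real.exp (ε * ‖x‖)) := by ring
    _ = _ := by rw [h4, mul_one]

end FourierDuality

/-! ### The damped inverse Fourier transform -/

section InverseFourier

variable {n : ℕ} {f K : EuclideanSpace ℝ (Fin n) → ℂ} {C : ℝ} {k : ℕ}
  {T : 𝓢'(EuclideanSpace ℝ (Fin n), ℂ)}

theorem HasInvFourier.congr_ae (h : HasInvFourier K T) (hf : f =ᵐ[volume] K) :
    HasInvFourier f T := by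
  have h1 : ∀ ε x, invFourierIntegrand f ε x =ᵐ[volume] invFourierIntegrand K ε x := by
    intro ε x
    filter_upwards [hf] with ξ hξ
    simp only [invFourierIntegrand, hξ]
  have h2 : ∀ ε x, invFourierDamped f ε x = invFourierDamped K ε x := fun ε x => by
    simp only [invFourierDamped, integral_congr_ae (h1 ε x)]
  refine ⟨fun ε hε x => (h.1 ε hε x).congr (h1 ε x).symm, fun ε hε φ => ?_, fun φ => ?_⟩
  · simpa only [h2] using h.2.1 ε hε φ
  · simpa only [h2] using h.2.2 φ

theorem invFourierIntegrand_eq (K : EuclideanSpace ℝ (Fin n) → ℂ) (ε : ℝ)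
    (x ξ : EuclideanSpace ℝ (Fin n)) :
    invFourierIntegrand K ε x ξ = Complex.exp (Complex.I * ((inner ℝ x ξ : ℝ) : ℂ)) *
      ((Real.exp (-ε * ‖ξ‖) : ℂ) * K ξ) := by
  rw [invFourierIntegrand, sub_eq_add_neg, Complex.exp_add]
  push_cast
  ring_nf

theorem integrable_exp_neg_mul {ε : ℝ} (hε : 0 < ε) (hK : AEStronglyMeasurable K)
    (hle : ∀ x, ‖K x‖ ≤ C * (1 + ‖x‖) ^ k) :
    Integrable fun ξ => (Real.exp (-ε * ‖ξ‖) : ℂ) * K ξ := by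
  refine ((integrable_one_add_norm_pow_mul_exp_neg hε k).const_mul C).mono'
    (AEStronglyMeasurable.mul (by fun_prop) hK) (ae_of_all _ fun ξ => ?_)
  rw [norm_mul, Complex.norm_real, Real.norm_eq_abs, Real.abs_exp, mul_comm, ← mul_assoc]
  exact mul_le_mul_of_nonneg_right (hle ξ) (Real.exp_pos _).le

/-- The substitution ξ = 2πη absorbs (2π)^{-n} and passes to the kernel e^{2πi⟨x,η⟩}. -/
theorem invFourierDamped_eq_fourierInv (K : EuclideanSpace ℝ (Fin n) → ℂ) (ε : ℝ) :
    invFourierDamped K ε = 𝓕⁻ fun η : EuclideanSpace ℝ (Fin n) =>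
      (Real.exp (-ε * ‖(2 * Real.pi) • η‖) : ℂ) * K ((2 * Real.pi) • η) := by
  ext x
  have h := Measure.integral_comp_smul (volume : Measure (EuclideanSpace ℝ (Fin n)))
    (invFourierIntegrand K ε x) (2 * Real.pi)
  rw [finrank_euclideanSpace_fin, abs_of_pos (by positivity), Complex.real_smul] at h
  rw [invFourierDamped, ← Complex.ofReal_inv, ← h, Real.fourierInv_eq']
  congr 1
  ext η
  rw [invFourierIntegrand_eq, smul_eq_mul, inner_smul_right, real_inner_comm x η]
  congr 2
  push_cast
  ring

/-- For ε > 0 the damped function is integrable, so duality moves the transform onto φ. The damping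
factor is then at most 1 against an integrable product, and dominated convergence removes it. -/
theorem hasInvFourier_of_growth (hK : Continuous K)
    (hle : ∀ x, ‖K x‖ ≤ C * (1 + ‖x‖) ^ k)
    (hT : ∀ φ, T φ = ∫ η, K ((2 * Real.pi) • η) * (𝓕⁻ φ) η) : HasInvFourier K T := by
  have hpi : 2 * Real.pi ≠ 0 := by positivity
  have hint : ∀ ε : ℝ, 0 < ε → Integrable fun η : EuclideanSpace ℝ (Fin n) =>
      (Real.exp (-ε * ‖(2 * Real.pi) • η‖) : ℂ) * K ((2 * Real.pi) • η) := fun ε hε =>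
    (integrable_exp_neg_mul hε hK.aestronglyMeasurable hle).comp_smul hpi
  refine ⟨fun ε hε x => ?_, fun ε hε φ => ?_, fun φ => ?_⟩
  · simp_rw [funext (invFourierIntegrand_eq K ε x)]
    refine (integrable_exp_neg_mul hε hK.aestronglyMeasurable hle).bdd_mul (c := 1) (by fun_prop)
      (ae_of_all _ fun ξ => ?_)
    rw [mul_comm, Complex.norm_exp_ofReal_mul_I]
  · rw [invFourierDamped_eq_fourierInv]
    exact φ.integrable.bdd_mul
      (continuous_fourierInv_of_integrable (hint ε hε)).aestronglyMeasurable
      (ae_of_all _ fun x => norm_fourierInv_le _ x)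
  · have hev : ∀ᶠ ε in 𝓝[>] (0 : ℝ), ∫ η, (Real.exp (-ε * ‖(2 * Real.pi) • η‖) : ℂ) *
        K ((2 * Real.pi) • η) * (𝓕⁻ φ) η = ∫ x, invFourierDamped K ε x * φ x := by
      filter_upwards [self_mem_nhdsWithin] with ε hε
      rw [invFourierDamped_eq_fourierInv, SchwartzMap.fourierInv_coe]
      exact (integral_fourierInv_mul_eq_of_integrable (hint ε hε) φ.integrable).symm
    refine Tendsto.congr' hev ?_
    rw [hT]
    have hC : ∀ η, ‖K ((2 * Real.pi) • η)‖ ≤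
        C * (1 + 2 * Real.pi) ^ k * (1 + ‖η‖) ^ k := by
      intro η
      refine (hle _).trans ?_
      have hC0 : 0 ≤ C := by
        have := (norm_nonneg _).trans (hle 0)
        simpa using this
      rw [mul_assoc, ← mul_pow, norm_smul, Real.norm_of_nonneg (by positivity)]
      gcongr
      nlinarith [norm_nonneg η, Real.pi_pos]
    have hKc : Continuous fun η : EuclideanSpace ℝ (Fin n) => K ((2 * Real.pi) • η) :=
      hK.comp (by fun_prop)
    have hI : Integrable fun η : EuclideanSpace ℝ (Fin n) => K ((2 * Real.pi) • η) * (𝓕⁻ φ) η :=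
      integrable_mul_schwartz (K := fun η => K ((2 * Real.pi) • η))
        (C := C * (1 + 2 * Real.pi) ^ k) (k := k) hKc.aestronglyMeasurable hC (𝓕⁻ φ)
    refine tendsto_integral_filter_of_dominated_convergence _ ?_ ?_ hI.norm ?_
    · refine Eventually.of_forall fun ε => Continuous.aestronglyMeasurable ?_
      have := (𝓕⁻ φ).continuous
      fun_prop
    · filter_upwards [self_mem_nhdsWithin] with ε hε
      refine ae_of_all _ fun η => ?_
      rw [mul_assoc, norm_mul, Complex.norm_real, Real.norm_eq_abs, Real.abs_exp]
      refine mul_le_of_le_one_left (norm_nonneg _) (Real.exp_le_one_iff.2 ?_)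
      have : 0 ≤ ε * ‖(2 * Real.pi) • η‖ := mul_nonneg (le_of_lt hε) (norm_nonneg _)
      linarith
    · refine ae_of_all _ fun η => tendsto_nhdsWithin_of_tendsto_nhds ?_
      have hc : Continuous fun ε : ℝ => (Real.exp (-ε * ‖(2 * Real.pi) • η‖) : ℂ) *
        K ((2 * Real.pi) • η) * (𝓕⁻ φ) η := by fun_prop
      have h0 := hc.tendsto 0
      rwa [neg_zero, zero_mul, Real.exp_zero, Complex.ofReal_one, one_mul] at h0

end InverseFourier

/-! ### The distribution family for all a -/

theorem exists_norm_ballPowerFourier_smul_le (n : ℕ) (R : ℝ) :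
    ∃ (C : ℝ) (k : ℕ), 0 ≤ C ∧ ∀ a : ℂ, ‖a‖ ≤ R → ∀ η : EuclideanSpace ℝ (Fin n),
      ‖ballPowerFourier n a ((2 * Real.pi) • η)‖ ≤ C * (1 + ‖η‖) ^ k := by
  obtain ⟨C, k, hC0, hC⟩ := exists_norm_ballPowerFourier_le n R
  refine ⟨C * (1 + 2 * Real.pi) ^ k, k, by positivity, fun a ha η => (hC a ha _).trans ?_⟩
  rw [mul_assoc, ← mul_pow, norm_smul, Real.norm_of_nonneg (by positivity)]
  gcongr
  nlinarith [norm_nonneg η, Real.pi_pos]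

theorem continuous_ballPowerFourier_smul (n : ℕ) (a : ℂ) :
    Continuous fun η : EuclideanSpace ℝ (Fin n) => ballPowerFourier n a ((2 * Real.pi) • η) :=
  (continuous_ballPowerFourier n a).comp (by fun_prop)

theorem exists_tempered_eq_integral_ballPowerFourier (n : ℕ) (a : ℂ) :
    ∃ T : 𝓢'(EuclideanSpace ℝ (Fin n), ℂ), ∀ φ : 𝓢(EuclideanSpace ℝ (Fin n), ℂ),
      T φ = ∫ η, ballPowerFourier n a ((2 * Real.pi) • η) * (𝓕⁻ φ) η := by
  obtain ⟨C, k, hC0, hC⟩ := exists_norm_ballPowerFourier_smul_le n ‖a‖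
  obtain ⟨L, hL⟩ := exists_clm_eq_integral_mul
    (continuous_ballPowerFourier_smul n a).aestronglyMeasurable hC0 (hC a le_rfl)
  refine ⟨ContinuousLinearMap.toPointwiseConvergenceCLM _ _ _ _ (L ∘L
    (FourierTransform.fourierCLE ℂ 𝓢(EuclideanSpace ℝ (Fin n), ℂ)).symm.toContinuousLinearMap),
    fun φ => hL _⟩

/-- The distribution `(1 - |x|²)₊^a / Γ(a + 1)` for every complex `a`, defined by its Fourier
transform. -/
def ballPowerDistribution (n : ℕ) (a : ℂ) : 𝓢'(EuclideanSpace ℝ (Fin n), ℂ) :=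
  (exists_tempered_eq_integral_ballPowerFourier n a).choose

theorem ballPowerDistribution_apply (n : ℕ) (a : ℂ) (φ : 𝓢(EuclideanSpace ℝ (Fin n), ℂ)) :
    ballPowerDistribution n a φ =
      ∫ η, ballPowerFourier n a ((2 * Real.pi) • η) * (𝓕⁻ φ) η :=
  (exists_tempered_eq_integral_ballPowerFourier n a).choose_spec φ

theorem differentiable_ballPowerDistribution (n : ℕ) (φ : 𝓢(EuclideanSpace ℝ (Fin n), ℂ)) :
    Differentiable ℂ fun a => ballPowerDistribution n a φ := by
  simp_rw [ballPowerDistribution_apply]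
  refine differentiable_integral_of_locally_dominated (fun a => ?_) (fun η => ?_) fun R => ?_
  · exact ((continuous_ballPowerFourier_smul n a).mul (𝓕⁻ φ).continuous).aestronglyMeasurable
  · exact (differentiable_ballPowerFourier _).mul_const _
  · obtain ⟨C, k, -, hC⟩ := exists_norm_ballPowerFourier_smul_le n R
    refine ⟨_, (integrable_one_add_norm_pow_mul_schwartz k (𝓕⁻ φ)).const_mul C,
      fun a ha η => ?_⟩
    rw [norm_mul, ← mul_assoc]
    exact mul_le_mul_of_nonneg_right (hC a ha η) (norm_nonneg _)

theorem integrable_ballPower_div {n : ℕ} {a : ℂ} (ha : -1 < a.re) (C : ℂ) :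
    Integrable (ballPower n a C) :=
  ((integrable_ballPower ha).div_const C).congr
    (ae_of_all _ fun x => (ballPower_eq_div n a C x).symm)

theorem fourier_ballPower {n : ℕ} {a : ℂ} (ha : -1 < a.re) (η : EuclideanSpace ℝ (Fin n)) :
    𝓕 (ballPower n a (Complex.Gamma (a + 1))) η = ballPowerFourier n a ((2 * Real.pi) • η) := by
  have h : ballPowerFourier n a ((2 * Real.pi) • η) =
      ballPowerFourier n a (-((2 * Real.pi) • η)) := by simp only [ballPowerFourier, norm_neg]
  rw [h, ← integral_cexp_mul_ballPower ha, Real.fourier_eq']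
  congr 1
  ext x
  rw [smul_eq_mul, inner_neg_left, inner_smul_left, real_inner_comm x η]
  congr 2
  simp
  ring

/-- For Re a > -1 the defining integral pairs the transform of an integrable function with the
inverse transform of φ; duality and Fourier inversion undo both. -/
theorem isNormalizedBallPowerFamily_ballPowerDistribution (n : ℕ) :
    IsNormalizedBallPowerFamily n (ballPowerDistribution n) := by
  refine ⟨differentiable_ballPowerDistribution n, fun a ha φ _ => ?_⟩
  have hi := integrable_ballPower_div (n := n) ha (Complex.Gamma (a + 1))
  refine ⟨integrable_mul_schwartz_of_integrable hi φ, ?_⟩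
  rw [ballPowerDistribution_apply]
  simp_rw [← fourier_ballPower ha]
  rw [integral_fourier_mul_eq_of_integrable hi (𝓕⁻ φ).integrable, ← SchwartzMap.fourier_coe,
    FourierTransform.fourier_fourierInv_eq]

/-! ### Analytic continuation off the sphere -/

section OffSphere

variable {n : ℕ} {φ : 𝓢(EuclideanSpace ℝ (Fin n), ℂ)}

/-- The part of the support in the closed ball is compact and misses the sphere. -/
theorem exists_forall_le_one_sub_sq (hφ : tsupport φ ⊆ {x | ‖x‖ ≠ 1}) :
    ∃ δ : ℝ, 0 < δ ∧ ∀ x, φ x ≠ 0 → ‖x‖ < 1 → δ ≤ 1 - ‖x‖ ^ 2 := by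
  have hc : IsCompact (Metric.closedBall (0 : EuclideanSpace ℝ (Fin n)) 1 ∩ tsupport φ) :=
    (isCompact_closedBall 0 1).inter_right (isClosed_tsupport φ)
  obtain ⟨δ, hδ, h⟩ := hc.exists_forall_le' (f := fun x => 1 - ‖x‖ ^ 2) (a := 0) (by fun_prop) <| by
    rintro x ⟨hx, hxs⟩
    have h1 : ‖x‖ < 1 := lt_of_le_of_ne (by simpa using hx) (hφ hxs)
    nlinarith [norm_nonneg x]
  exact ⟨δ, hδ, fun x hx hx1 => h x ⟨by simpa using hx1.le, subset_tsupport _ hx⟩⟩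

theorem exists_norm_ballPower_mul_le (hφ : tsupport φ ⊆ {x | ‖x‖ ≠ 1}) (R : ℝ) :
    ∃ C : ℝ, ∀ a : ℂ, ‖a‖ ≤ R → ∀ x, ‖ballPower n a 1 x * φ x‖ ≤ C * ‖φ x‖ := by
  obtain ⟨δ, hδ, h⟩ := exists_forall_le_one_sub_sq hφ
  refine ⟨Real.exp (|Real.log δ| * R), fun a ha x => ?_⟩
  rw [norm_mul]
  by_cases hx : φ x = 0
  · simp [hx]
  refine mul_le_mul_of_nonneg_right ?_ (norm_nonneg _)
  unfold ballPower
  split_ifs with hx1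
  · have hd := h x hx hx1
    have hd0 : 0 < 1 - ‖x‖ ^ 2 := hδ.trans_le hd
    rw [div_one, Complex.norm_cpow_eq_rpow_re_of_pos hd0, Real.rpow_def_of_pos hd0]
    refine Real.exp_le_exp.2 ((le_abs_self _).trans ?_)
    rw [abs_mul]
    refine mul_le_mul ?_ ((Complex.abs_re_le_norm a).trans ha) (abs_nonneg _) (abs_nonneg _)
    have h1 := Real.log_le_log hδ hd
    have h2 := Real.log_nonpos hd0.le (by nlinarith [norm_nonneg x])
    rw [abs_of_nonpos h2, abs_of_nonpos (h1.trans h2)]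
    linarith
  · rw [norm_zero]
    positivity

theorem integrable_ballPower_mul (hφ : tsupport φ ⊆ {x | ‖x‖ ≠ 1}) (a : ℂ) :
    Integrable fun x => ballPower n a 1 x * φ x := by
  obtain ⟨C, hC⟩ := exists_norm_ballPower_mul_le hφ ‖a‖
  exact (φ.integrable.norm.const_mul C).mono'
    ((measurable_ballPower n a 1).aestronglyMeasurable.mul φ.continuous.aestronglyMeasurable)
    (ae_of_all _ (hC a le_rfl))

theorem differentiable_ballPower (x : EuclideanSpace ℝ (Fin n)) :
    Differentiable ℂ fun a => ballPower n a 1 x := by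
  unfold ballPower
  split_ifs with hx
  · have h1 : ((1 - ‖x‖ ^ 2 : ℝ) : ℂ) ≠ 0 := by
      have : 0 < 1 - ‖x‖ ^ 2 := by nlinarith [norm_nonneg x]
      exact_mod_cast this.ne'
    exact (differentiable_id.const_cpow (Or.inl h1)).div_const 1
  · exact differentiable_const _

theorem differentiable_integral_ballPower_mul (hφ : tsupport φ ⊆ {x | ‖x‖ ≠ 1}) :
    Differentiable ℂ fun a => ∫ x, ballPower n a 1 x * φ x := by
  refine differentiable_integral_of_locally_dominated
    (fun a => (integrable_ballPower_mul hφ a).aestronglyMeasurable)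
    (fun x => (differentiable_ballPower x).mul_const _) fun R => ?_
  obtain ⟨C, hC⟩ := exists_norm_ballPower_mul_le hφ R
  exact ⟨_, φ.integrable.norm.const_mul C, hC⟩

/-- Both sides are entire in a, as 1/Γ is, and agree for Re a > -1. At poles of Γ the convention 1/0
= 0 gives the right value. -/
theorem IsNormalizedBallPowerFamily.representedOn_compl_sphere
    {G : ℂ → 𝓢'(EuclideanSpace ℝ (Fin n), ℂ)} (hG : IsNormalizedBallPowerFamily n G) (a : ℂ) :
    RepresentedOn {x | ‖x‖ ≠ 1} (G a) (ballPower n a (Complex.Gamma (a + 1))) := by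
  intro φ hφ
  have he : ∀ a x, ballPower n a (Complex.Gamma (a + 1)) x * φ x =
      (Complex.Gamma (a + 1))⁻¹ * (ballPower n a 1 x * φ x) := fun a x => by
    rw [ballPower_eq_div]
    ring
  simp_rw [he]
  refine ⟨(integrable_ballPower_mul hφ a).const_mul _, ?_⟩
  rw [integral_const_mul]
  refine congrFun (eq_of_differentiable_of_eq_of_re_gt (c := -1) (hG.1 φ)
    (g := fun a => (Complex.Gamma (a + 1))⁻¹ * ∫ x, ballPower n a 1 x * φ x) ?_ fun a ha => ?_) a
  · exact (Complex.differentiable_one_div_Gamma.comp (differentiable_id.add_const 1)).mul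
      (differentiable_integral_ballPower_mul hφ)
  · rw [(hG.2 a ha φ (Set.subset_univ _)).2]
    simp_rw [he]
    rw [integral_const_mul]

end OffSphere

/-! ### The Bessel transforms and the reflection formula -/

theorem RepresentedOn.inv_smul_ballPower {n : ℕ} {U : Set (EuclideanSpace ℝ (Fin n))}
    {T : 𝓢'(EuclideanSpace ℝ (Fin n), ℂ)} {a C : ℂ} (h : RepresentedOn U T (ballPower n a C))
    (c : ℂ) : RepresentedOn U (c⁻¹ • T) (ballPower n a (c * C)) := by
  intro φ hφ
  have he : ∀ x, ballPower n a (c * C) x * φ x = c⁻¹ * (ballPower n a C x * φ x) := fun x => by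
    rw [ballPower_eq_div, ballPower_eq_div n a C]
    simp only [div_eq_mul_inv, mul_inv]
    ring
  simp_rw [he]
  refine ⟨(h φ hφ).1.const_mul _, ?_⟩
  rw [integral_const_mul, ← (h φ hφ).2]
  rfl

theorem powBessel_neg_eq {n : ℕ} (ν : ℂ) {ξ : EuclideanSpace ℝ (Fin n)} (hξ : ξ ≠ 0) :
    powBessel n (-ν) ν ξ = ((2 : ℂ) ^ ν * (Real.pi : ℂ) ^ ((n : ℂ) / 2))⁻¹ *
      ballPowerFourier n (ν - n / 2) ξ := by
  have h1 : (2 : ℂ) ^ ν ≠ 0 := by simp [Complex.cpow_eq_zero_iff]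
  have h2 : (Real.pi : ℂ) ^ ((n : ℂ) / 2) ≠ 0 := by
    simp [Complex.cpow_eq_zero_iff, Real.pi_ne_zero]
  rw [powBessel, cpow_neg_mul_besselJ ν (norm_pos_iff.2 hξ), ballPowerFourier, sub_add_cancel,
    Complex.cpow_neg]
  field_simp

theorem hasInvFourier_powBessel {n : ℕ} (hn : 1 ≤ n) (ν : ℂ) :
    HasInvFourier (powBessel n (-ν) ν) (((2 : ℂ) ^ ν * (Real.pi : ℂ) ^ ((n : ℂ) / 2))⁻¹ •
      ballPowerDistribution n (ν - n / 2)) := by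
  set c : ℂ := ((2 : ℂ) ^ ν * (Real.pi : ℂ) ^ ((n : ℂ) / 2))⁻¹ with hc
  obtain ⟨C, k, -, hC⟩ := exists_norm_ballPowerFourier_le n ‖ν - n / 2‖
  have h : HasInvFourier (fun ξ => c * ballPowerFourier n (ν - n / 2) ξ)
      (c • ballPowerDistribution n (ν - n / 2)) := by
    refine hasInvFourier_of_growth (C := ‖c‖ * C) (k := k)
      (continuous_const.mul (continuous_ballPowerFourier n _)) (fun ξ => ?_) fun φ => ?_
    · rw [norm_mul, mul_assoc]
      exact mul_le_mul_of_nonneg_left (hC _ le_rfl ξ) (norm_nonneg _)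
    · simp_rw [mul_assoc]
      rw [integral_const_mul, ← ballPowerDistribution_apply]
      rfl
  refine h.congr_ae ?_
  -- In positive dimension the origin, where the principal powers of 0 take default values, is a
  -- null set.
  have : Nonempty (Fin n) := ⟨⟨0, hn⟩⟩
  filter_upwards [compl_mem_ae_iff.2 (measure_singleton (0 : EuclideanSpace ℝ (Fin n)))] with ξ hξ
  exact powBessel_neg_eq ν hξ

theorem hasBallPowerInvFourier_powBessel {n : ℕ} (hn : 1 ≤ n) (ν : ℂ) :
    HasBallPowerInvFourier (ballPowerDistribution n) (powBessel n (-ν) ν) (ν - n / 2)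
      ((2 : ℂ) ^ ν * (Real.pi : ℂ) ^ ((n : ℂ) / 2)) := by
  have hG := isNormalizedBallPowerFamily_ballPowerDistribution n
  exact ⟨hasInvFourier_powBessel hn ν, (hG.representedOn_compl_sphere _).inv_smul_ballPower _,
    fun ha => (hG.2 _ ha).inv_smul_ballPower _⟩

/-- Euler's reflection formula at ν + μ. Positive real part makes Γ(ν + μ) nonzero, so the formula
can be solved for 1/Γ(1 - ν - μ), zeros included. -/
theorem one_div_Gamma_one_sub_eq (ν μ : ℂ) (hμ : 0 < (ν + μ).re) :
    1 / ((2 : ℂ) ^ (-ν) * (Real.pi : ℂ) ^ μ * Complex.Gamma (1 - ν - μ)) =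
      (2 : ℂ) ^ ν * Complex.sin ((ν + μ) * (Real.pi : ℂ)) * Complex.Gamma (ν + μ) /
        (Real.pi : ℂ) ^ (μ + 1) := by
  have hpi : (Real.pi : ℂ) ≠ 0 := by exact_mod_cast Real.pi_ne_zero
  have h1 : (2 : ℂ) ^ ν ≠ 0 := by simp [Complex.cpow_eq_zero_iff]
  have h2 : (Real.pi : ℂ) ^ μ ≠ 0 := by simp [Complex.cpow_eq_zero_iff, hpi]
  have hΓ := Complex.Gamma_ne_zero_of_re_pos hμ
  have hr := Complex.Gamma_mul_Gamma_one_sub (ν + μ)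
  have hinv : (Complex.Gamma (1 - ν - μ))⁻¹ =
      Complex.Gamma (ν + μ) * Complex.sin ((ν + μ) * Real.pi) / Real.pi := by
    have h3 : (Complex.Gamma (ν + μ) * Complex.Gamma (1 - (ν + μ)))⁻¹ =
        Complex.sin ((ν + μ) * Real.pi) / Real.pi := by
      rw [hr, inv_div, mul_comm (Real.pi : ℂ)]
    rw [mul_inv, inv_mul_eq_iff_eq_mul₀ hΓ, ← sub_sub] at h3
    rw [h3, mul_div_assoc]
  rw [one_div, mul_inv, mul_inv, hinv, Complex.cpow_neg, inv_inv, Complex.cpow_add _ _ hpi,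
    Complex.cpow_one]
  field_simp

end

theorem theorem3p3 (n : ℕ) (hn : 1 ≤ n) :
    ∃ G : ℂ → 𝓢'(EuclideanSpace ℝ (Fin n), ℂ),
      IsNormalizedBallPowerFamily n G ∧
      (∀ G' : ℂ → 𝓢'(EuclideanSpace ℝ (Fin n), ℂ),
        IsNormalizedBallPowerFamily n G' → G' = G) ∧
      ∀ ν : ℂ, |ν.re| < 1 / 2 →
        HasBallPowerInvFourier G (powBessel n (-ν) ν)
          (ν - (n : ℂ) / 2) ((2 : ℂ) ^ ν * (Real.pi : ℂ) ^ ((n : ℂ) / 2)) ∧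
        HasBallPowerInvFourier G (powBessel n ν (-ν))
          (-ν - (n : ℂ) / 2) ((2 : ℂ) ^ (-ν) * (Real.pi : ℂ) ^ ((n : ℂ) / 2)) ∧
        1 / ((2 : ℂ) ^ (-ν) * (Real.pi : ℂ) ^ ((n : ℂ) / 2) *
            Complex.Gamma (1 - ν - (n : ℂ) / 2)) =
          (2 : ℂ) ^ ν * Complex.sin ((ν + (n : ℂ) / 2) * (Real.pi : ℂ)) *
            Complex.Gamma (ν + (n : ℂ) / 2) / (Real.pi : ℂ) ^ ((n : ℂ) / 2 + 1) := by
  refine ⟨ballPowerDistribution n, isNormalizedBallPowerFamily_ballPowerDistribution n,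
    fun G' hG' => (isNormalizedBallPowerFamily_ballPowerDistribution n).unique hG',
    fun ν hν => ⟨hasBallPowerInvFourier_powBessel hn ν, ?_, ?_⟩⟩
  · simpa only [neg_neg] using hasBallPowerInvFourier_powBessel hn (-ν)
  -- Positivity holds because Re ν > -1/2 and n/2 ≥ 1/2.
  · refine one_div_Gamma_one_sub_eq ν (n / 2) ?_
    have h1 : ν + (n : ℂ) / 2 = ν + ((n / 2 : ℝ) : ℂ) := by push_cast; ring
    have h2 : (1 : ℝ) ≤ n := by exact_mod_cast hn
    rw [h1, Complex.add_re, Complex.ofReal_re]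
    linarith [neg_abs_le ν.re]
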